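/- Let $\mathcal M=(\mathcal S,\mathcal A,R,p,H)$ be a finite-horizon MDP with finite non-empty state and action spaces, $S=|\mathcal S|$, horizon $H$, rewards $R(s,a)\in[0,1]$ with mean $r(s,a)$, and time-independent transition probabilities $p(\cdot\mid s,a)$. For a deterministic policy $\pi:\mathcal S\times\{1,\dots,H\}\to\mathcal A$ let $V^\pi_t(s)=\mathbb E\big[\sum_{t'=t}^H r(s_{t'},\pi(s_{t'},t'))\mid s_t=s\big]$, and let $V^*_t(s)=\max_\pi V^\pi_t(s)$. RTDP, which knows $r$ and $p$, maintains values $\bar V^k_t(s)$ with $\bar V^0_t(s)=H-(t-1)$ for $1\le t\le H$ and $\bar V^k_{H+1}=0$ for all $k$. In each episode $k=1,2,\dots$ it starts at a state $s_1^k$, which is chosen arbitrarily (possibly at random and depending on the past), and follows a policy $\pi_k$ that is greedy with respect to $\bar V^{k-1}$, i.e. $\pi_k(s,t)\in\arg\max_a\{r(s,a)+p(\cdot\mid s,a)^{T}\bar V^{k-1}_{t+1}\}$ for all $s,t$, ties being broken in any way that depends only on the information $\mathcal F_{k-1}$ available at the start of the episode (the past episodes and $s^k_1$). At time-steps $t=1,\dots,H$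 it takes the action $a_t^k=\pi_k(s_t^k,t)$, sets $\bar V^k_t(s^k_t)=r(s^k_t,a^k_t)+p(\cdot\mid s^k_t,a^k_t)^{T}\bar V^{k-1}_{t+1}$ and moves to $s^k_{t+1}$, whose law given the past is $p(\cdot\mid s^k_t,a^k_t)$; for $s\ne s^k_t$, $\bar V^k_t(s)=\bar V^{k-1}_t(s)$. Let $\mathrm{Regret}(K)=\sum_{k=1}^K\big(V^*_1(s_1^k)-V_1^{\pi_k}(s_1^k)\big)$. Then: 1. For every $K$, $\mathbb E[\mathrm{Regret}(K)]\le SH^2$. 2. For every $\delta>0$, with probability at least $1-\delta$, for all $K>0$ simultaneously, $\mathrm{Regret}(K)\le 9SH^2\ln(3SH/\delta)$. In particular, the bounds do not depend on the number $T=KH$ of time-steps. -/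

import Mathlib

open MeasureTheory

/-- A finite-horizon MDP with time-independent dynamics: horizon `H`, reward distributions
`R s a` supported in `[0, 1]`, and transition probabilities `p s a`.

Time-steps are counted from `0`: the time-step `t : Fin H` is the one usually written `t + 1`. -/
structure FiniteHorizonMDP (S A : Type*) where
  H : ℕ
  R : S → A → Measure ℝ
  isProbabilityMeasure_R : ∀ s a, IsProbabilityMeasure (R s a)
  R_mem_Icc : ∀ s a, ∀ᵐ x ∂(R s a), x ∈ Set.Icc (0 : ℝ) 1
  p : S → A → PMF S

namespace FiniteHorizonMDP

variable {S A : Type*} (M : FiniteHorizonMDP S A)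

/-- The expected immediate reward. -/
noncomputable def r (s : S) (a : A) : ℝ := ∫ x, x ∂(M.R s a)

/-- Deterministic (time-dependent) policies. -/
abbrev Policy : Type _ := Fin M.H → S → A

/-- The law of the state `s_{t'}` when `s_t = s` and the actions are taken according to `π`
(for `t ≤ t' ≤ H`). -/
noncomputable def stateLaw (π : M.Policy) (t : ℕ) (s : S) : ℕ → PMF S
  | 0 => PMF.pure s
  | t' + 1 =>
    if h : t ≤ t' ∧ t' < M.H then
      (stateLaw π t s t').bind fun x => M.p x (π ⟨t', h.2⟩ x)
    else PMF.pure s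

variable [Fintype S]

/-- The value of `π` from state `s` at time `t`: the expected sum of the mean rewards collected
from time `t` to the end of the episode. -/
noncomputable def value (π : M.Policy) (t : ℕ) (s : S) : ℝ :=
  ∑ t' ∈ Finset.univ.filter (fun i : Fin M.H => t ≤ (i : ℕ)),
    ∑ x : S, (M.stateLaw π t s t' x).toReal * M.r x (π t' x)

/-- The optimal value, the maximum of the values of all deterministic policies (there are finitely
many of them for a finite action space, so that the supremum is a maximum). -/
noncomputable def optValue (t : ℕ) (s : S) : ℝ := ⨆ π : M.Policy, M.value π t s

/-- One-step lookahead `r(s, a) + p(· ∣ s, a)ᵀ v`. -/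
noncomputable def lookahead (v : S → ℝ) (s : S) (a : A) : ℝ :=
  M.r s a + ∑ x : S, (M.p s a x).toReal * v x

open Classical in
/-- The value function held by RTDP after `k` episodes, when `π j` is the policy and `s j t` the
state at time-step `t` of episode `j` (episodes are counted from `0` too).
It starts from the optimistic value `H - t`; in each episode the entries of the visited pairs
(time-step, state) are overwritten by the one-step lookahead on the value function at the end of
the previous episode, and all others are kept. The entry at time `H` is the terminal value `0`. -/
noncomputable def rtdpValue (π : ℕ → M.Policy) (s : ℕ → Fin (M.H + 1) → S) :
    ℕ → Fin (M.H + 1) → S → ℝ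
  | 0, t, _ => (M.H : ℝ) - (t : ℕ)
  | k + 1, t, x =>
    if h : (t : ℕ) < M.H ∧ x = s k t then
      M.lookahead (rtdpValue π s k (Fin.succ ⟨t, h.1⟩)) x (π k ⟨t, h.1⟩ x)
    else rtdpValue π s k t x

/-- `π` acts greedily with respect to the value function `v` at the next time-step. -/
def IsGreedy (v : Fin (M.H + 1) → S → ℝ) (π : M.Policy) : Prop :=
  ∀ (t : Fin M.H) (x : S) (a : A),
    M.lookahead (v t.succ) x a ≤ M.lookahead (v t.succ) x (π t x)

/-- A run of RTDP on `M`, on a probability space `(Ω, μ)` with a filtration `𝓖` indexed by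
(episode, time-step) in lexicographic order.

`𝓖 (k, t)` is the information available in episode `k` when the state at time `t` has been
observed, before acting; in particular `𝓖 (k, 0)` holds everything that happened in the previous
episodes together with the initial state of episode `k`. The initial states `state k 0` are
arbitrary: they may depend on the past in any way, and be randomized. Ties in the greedy choice may
be broken in any way that depends only on what is known at the start of the episode. -/
structure RTDPRun [MeasurableSpace S] [MeasurableSpace A] {Ω : Type*} [mΩ : MeasurableSpace Ω]
    (μ : Measure Ω) (𝓖 : Filtration (ℕ ×ₗ Fin (M.H + 1)) mΩ) where
  /-- `state k t` is the state at time-step `t` of episode `k`. -/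
  state : ℕ → Fin (M.H + 1) → Ω → S
  /-- `reward k t` is the reward observed at time-step `t` of episode `k`. -/
  reward : ℕ → Fin M.H → Ω → ℝ
  /-- `policy k` is the policy of episode `k`. -/
  policy : ℕ → Ω → M.Policy
  measurable_state : ∀ k t, Measurable[𝓖 (toLex (k, t))] (state k t)
  measurable_reward : ∀ k t, Measurable[𝓖 (toLex (k, Fin.succ t))] (reward k t)
  measurable_policy : ∀ k, Measurable[𝓖 (toLex (k, 0))] (policy k)
  /-- The policy is greedy with respect to the current value function. -/
  greedy : ∀ k ω,
    M.IsGreedy (M.rtdpValue (fun j => policy j ω) (fun j t => state j t ω) k) (policy k ω)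
  /-- Given the past, the next state has the law `p(· ∣ s, a)`, where `a` is the action taken. -/
  condLaw_state : ∀ (k : ℕ) (t : Fin M.H) (y : S),
    μ[Set.indicator {ω | state k t.succ ω = y} (fun _ => (1 : ℝ)) | 𝓖 (toLex (k, t.castSucc))]
      =ᵐ[μ] fun ω =>
        (M.p (state k t.castSucc ω) (policy k ω t (state k t.castSucc ω)) y).toReal
  /-- Given the past, the reward has the law `R(s, a)`. -/
  condLaw_reward : ∀ (k : ℕ) (t : Fin M.H) (B : Set ℝ), MeasurableSet B →
    μ[Set.indicator {ω | reward k t ω ∈ B} (fun _ => (1 : ℝ)) | 𝓖 (toLex (k, t.castSucc))]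
      =ᵐ[μ] fun ω =>
        (M.R (state k t.castSucc ω) (policy k ω t (state k t.castSucc ω))).real B

/-- The regret over the first `K` episodes. -/
noncomputable def RTDPRun.regret {M : FiniteHorizonMDP S A} [MeasurableSpace S]
    [MeasurableSpace A] {Ω : Type*} [mΩ : MeasurableSpace Ω] {μ : Measure Ω}
    {𝓖 : Filtration (ℕ ×ₗ Fin (M.H + 1)) mΩ} (X : M.RTDPRun μ 𝓖) (K : ℕ) (ω : Ω) : ℝ :=
  ∑ k ∈ Finset.range K,
    (M.optValue 0 (X.state k 0 ω) - M.value (X.policy k ω) 0 (X.state k 0 ω))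

end FiniteHorizonMDP

/-! Optimism turns regret into a decrease of stored values, and that decrease has a finite budget.
The inequality "lookahead ≤ stored value" survives every update, so the stored values dominate every
policy's value and only go down. Each of the `S * H` entries stays in `[0, H]`, so the decreases
over all episodes sum to at most `S * H ^ 2` on every path (`sum_decrement_le`).

At a visited state, the gap between stored and policy value is the decrease there plus the mean gap
at the next state (`gap_castSucc`). Hence the initial gap `g`, which bounds the episode's regret, is
the conditional mean of the episode's total decrease `D` (`integral_mul_gap_zero`). Summing gives
the bound in expectation.

For the tail, put `B = H ^ 2`, so `0 ≤ D ≤ B`. The exponential of the sum of `g / (2 * B) - D / B`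
has non-increasing mean (`integral_expGap_succ_le`). Markov's inequality and the budget give
`P(Regret > T) ≤ exp (S - T / (2 * B))`. Regret is monotone in `K`, so uniformity in `K` needs no
union bound. -/

namespace FiniteHorizonMDP

/-! ### Bellman equation and bounds for policy values -/

section Bellman

variable {S A : Type*} (M : FiniteHorizonMDP S A)

lemma r_nonneg (s : S) (a : A) : 0 ≤ M.r s a :=
  integral_nonneg_of_ae ((M.R_mem_Icc s a).mono fun _ hx => hx.1)

lemma r_le_one (s : S) (a : A) : M.r s a ≤ 1 := by
  have := M.isProbabilityMeasure_R s a
  calc ∫ x, x ∂(M.R s a) ≤ ∫ _, (1 : ℝ) ∂(M.R s a) :=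
        integral_mono_of_nonneg ((M.R_mem_Icc s a).mono fun _ hx => hx.1) (integrable_const 1)
          ((M.R_mem_Icc s a).mono fun _ hx => hx.2)
    _ = 1 := by simp

lemma stateLaw_self (π : M.Policy) (t : ℕ) (s : S) : M.stateLaw π t s t = PMF.pure s := by
  cases t <;> simp [stateLaw]

lemma stateLaw_succ (π : M.Policy) {t t' : ℕ} (s : S) (h : t ≤ t') (h' : t' < M.H) :
    M.stateLaw π t s (t' + 1) =
      (M.stateLaw π t s t').bind fun x => M.p x (π ⟨t', h'⟩ x) := by
  simp [stateLaw, h, h']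

/-- `stateLaw` recurses on the last transition, while the Bellman equation conditions on the first;
associativity of `bind` converts one into the other. -/
lemma stateLaw_eq_bind (π : M.Policy) {t : ℕ} (ht : t < M.H) (s : S) {t' : ℕ}
    (h : t + 1 ≤ t') (h' : t' ≤ M.H) :
    M.stateLaw π t s t' =
      (M.p s (π ⟨t, ht⟩ s)).bind fun y => M.stateLaw π (t + 1) y t' := by
  induction t', h using Nat.le_induction with
  | base =>
    simp_rw [stateLaw_self]
    rw [M.stateLaw_succ π s le_rfl ht, stateLaw_self, PMF.pure_bind, PMF.bind_pure]
  | succ n hn ih =>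
    rw [M.stateLaw_succ π s (by omega) (by omega), ih (by omega), PMF.bind_bind]
    congr 1
    funext y
    rw [M.stateLaw_succ π y hn (by omega)]

variable [Fintype S]

lemma sum_toReal_pmf (q : PMF S) : ∑ x, (q x).toReal = 1 := by
  rw [← ENNReal.toReal_sum fun x _ => q.apply_ne_top x, ← tsum_fintype (L := .unconditional S),
    q.tsum_coe, ENNReal.toReal_one]

lemma toReal_bind_apply (q : PMF S) (f : S → PMF S) (x : S) :
    (q.bind f x).toReal = ∑ y, (q y).toReal * (f y x).toReal := by
  rw [PMF.bind_apply, tsum_fintype,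
    ENNReal.toReal_sum fun y _ => ENNReal.mul_ne_top (q.apply_ne_top y) ((f y).apply_ne_top x)]
  simp_rw [ENNReal.toReal_mul]

lemma lookahead_mono {v w : S → ℝ} (h : ∀ x, v x ≤ w x) (s : S) (a : A) :
    M.lookahead v s a ≤ M.lookahead w s a := by
  unfold lookahead
  gcongr with x
  exact h x

lemma lookahead_const_le (c : ℝ) (s : S) (a : A) : M.lookahead (fun _ => c) s a ≤ 1 + c := by
  unfold lookahead
  rw [← Finset.sum_mul, sum_toReal_pmf, one_mul]
  gcongr
  exact M.r_le_one s a

/-- The Bellman equation for the value of a policy. -/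
lemma value_eq_lookahead (π : M.Policy) (t : Fin M.H) (s : S) :
    M.value π t s = M.lookahead (M.value π (t + 1)) s (π t s) := by
  classical
  have hset : Finset.univ.filter (fun i : Fin M.H => (t : ℕ) ≤ i) =
      insert t (Finset.univ.filter (fun i : Fin M.H => (t : ℕ) + 1 ≤ i)) := by
    ext i
    simp only [Finset.mem_filter, Finset.mem_univ, true_and, Finset.mem_insert, Fin.ext_iff]
    omega
  unfold value lookahead
  rw [hset, Finset.sum_insert (fun h => by simp at h)]
  congr 1
  · rw [stateLaw_self, Finset.sum_eq_single_of_mem s (Finset.mem_univ s)]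
    · simp
    · intro x _ hx
      simp [hx]
  · symm
    simp_rw [Finset.mul_sum]
    rw [Finset.sum_comm]
    refine Finset.sum_congr rfl fun i hi => ?_
    rw [Finset.sum_comm]
    refine Finset.sum_congr rfl fun x _ => ?_
    rw [M.stateLaw_eq_bind π t.2 s (Finset.mem_filter.1 hi).2 i.2.le, toReal_bind_apply,
      Finset.sum_mul]
    simp_rw [mul_assoc]

lemma value_horizon (π : M.Policy) (s : S) : M.value π M.H s = 0 := by
  unfold value
  rw [Finset.filter_false_of_mem (by simp), Finset.sum_empty]

lemma value_nonneg (π : M.Policy) (t : ℕ) (s : S) : 0 ≤ M.value π t s :=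
  Finset.sum_nonneg fun _ _ => Finset.sum_nonneg fun _ _ =>
    mul_nonneg ENNReal.toReal_nonneg (M.r_nonneg _ _)

lemma value_le (π : M.Policy) (t : Fin (M.H + 1)) (s : S) : M.value π t s ≤ M.H - (t : ℕ) := by
  induction t using Fin.reverseInduction generalizing s with
  | last => simp [value_horizon]
  | cast t ih =>
    rw [Fin.val_castSucc, value_eq_lookahead]
    refine (M.lookahead_mono (w := fun _ => (M.H : ℝ) - (t + 1 : ℕ))
      (fun x => by simpa using ih x) _ _).trans ((M.lookahead_const_le _ _ _).trans ?_)
    push_cast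
    linarith

lemma bddAbove_range_value (t : Fin (M.H + 1)) (s : S) :
    BddAbove (Set.range fun π : M.Policy => M.value π t s) :=
  ⟨M.H - (t : ℕ), Set.forall_mem_range.2 fun π => M.value_le π t s⟩

end Bellman

/-! ### Pathwise properties of the stored values: monotonicity, optimism, total decrease -/

section Deterministic

variable {S A : Type*} [Fintype S] (M : FiniteHorizonMDP S A) (π : ℕ → M.Policy)
  (s : ℕ → Fin (M.H + 1) → S)

lemma rtdpValue_succ_self (k : ℕ) (t : Fin M.H) :
    M.rtdpValue π s (k + 1) t.castSucc (s k t.castSucc) =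
      M.lookahead (M.rtdpValue π s k t.succ) (s k t.castSucc) (π k t (s k t.castSucc)) := by
  simp [rtdpValue]

lemma rtdpValue_succ_of_ne (k : ℕ) (t : Fin (M.H + 1)) {x : S} (h : x ≠ s k t) :
    M.rtdpValue π s (k + 1) t x = M.rtdpValue π s k t x := by
  simp [rtdpValue, h]

lemma rtdpValue_last (k : ℕ) (x : S) : M.rtdpValue π s k (Fin.last M.H) x = 0 := by
  induction k with
  | zero => simp [rtdpValue]
  | succ k ih => simp [rtdpValue, ih]

variable {M π s}

/-- The invariant at `k` is a hypothesis here so that the induction proving it can use this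
monotonicity. -/
lemma rtdpValue_succ_le_of_lookahead_le {k : ℕ}
    (h : ∀ (t : Fin M.H) x a, M.lookahead (M.rtdpValue π s k t.succ) x a ≤
      M.rtdpValue π s k t.castSucc x) (t : Fin (M.H + 1)) (x : S) :
    M.rtdpValue π s (k + 1) t x ≤ M.rtdpValue π s k t x := by
  induction t using Fin.lastCases with
  | last => simp [rtdpValue_last]
  | cast t =>
    by_cases hx : x = s k t.castSucc
    · subst hx
      rw [rtdpValue_succ_self]
      exact h t _ _
    · rw [rtdpValue_succ_of_ne _ _ _ _ _ hx]

variable (hg : ∀ k, M.IsGreedy (M.rtdpValue π s k) (π k))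
include hg

/-- Initially this holds because rewards are at most 1. An update lowers the next-step values, hence
every lookahead; at the visited state the new entry is the greedy, hence maximal, lookahead on the
old values. -/
lemma lookahead_rtdpValue_le (k : ℕ) (t : Fin M.H) (x : S) (a : A) :
    M.lookahead (M.rtdpValue π s k t.succ) x a ≤ M.rtdpValue π s k t.castSucc x := by
  induction k generalizing t x a with
  | zero =>
    refine (M.lookahead_const_le ((M.H : ℝ) - (t.succ : ℕ)) x a).trans ?_
    simp only [rtdpValue, Fin.val_succ, Fin.val_castSucc, Nat.cast_add, Nat.cast_one]
    linarith
  | succ k ih =>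
    have hle := M.lookahead_mono (rtdpValue_succ_le_of_lookahead_le ih t.succ) x a
    by_cases hx : x = s k t.castSucc
    · subst hx
      rw [rtdpValue_succ_self]
      exact hle.trans (hg k t _ a)
    · rw [rtdpValue_succ_of_ne _ _ _ _ _ hx]
      exact hle.trans (ih t x a)

lemma rtdpValue_succ_le (k : ℕ) (t : Fin (M.H + 1)) (x : S) :
    M.rtdpValue π s (k + 1) t x ≤ M.rtdpValue π s k t x :=
  rtdpValue_succ_le_of_lookahead_le (lookahead_rtdpValue_le hg k) t x

lemma rtdpValue_le (k : ℕ) (t : Fin (M.H + 1)) (x : S) : M.rtdpValue π s k t x ≤ M.H := by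
  induction k with
  | zero => simp [rtdpValue]
  | succ k ih => exact (rtdpValue_succ_le hg k t x).trans ih

/-- The values held by RTDP are optimistic. -/
lemma value_le_rtdpValue (k : ℕ) (ρ : M.Policy) (t : Fin (M.H + 1)) (x : S) :
    M.value ρ t x ≤ M.rtdpValue π s k t x := by
  induction t using Fin.reverseInduction generalizing x with
  | last => simp [value_horizon, rtdpValue_last]
  | cast t ih =>
    rw [Fin.val_castSucc, value_eq_lookahead]
    exact (M.lookahead_mono (fun y => by simpa using ih y) _ _).trans
      (lookahead_rtdpValue_le hg k t x _)

lemma rtdpValue_nonneg (k : ℕ) (t : Fin (M.H + 1)) (x : S) : 0 ≤ M.rtdpValue π s k t x :=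
  (M.value_nonneg (π 0) t x).trans (value_le_rtdpValue hg k (π 0) t x)

lemma optValue_le_rtdpValue (k : ℕ) (t : Fin (M.H + 1)) (x : S) :
    M.optValue t x ≤ M.rtdpValue π s k t x :=
  have : Nonempty M.Policy := ⟨π 0⟩
  ciSup_le fun ρ => value_le_rtdpValue hg k ρ t x

omit hg in
/-- The total decrease of the values in an episode happens at the visited states. -/
lemma sum_sub_rtdpValue_eq (k : ℕ) (t : Fin (M.H + 1)) :
    ∑ x, (M.rtdpValue π s k t x - M.rtdpValue π s (k + 1) t x) =
      M.rtdpValue π s k t (s k t) - M.rtdpValue π s (k + 1) t (s k t) := by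
  refine Finset.sum_eq_single (s k t) (fun x _ hx => ?_) (by simp)
  rw [rtdpValue_succ_of_ne _ _ _ _ _ hx, sub_self]

/-- Unvisited entries do not change, so the sum may run over all states; it then telescopes in `k`
for each entry, within `[0, H]`. -/
lemma sum_decrement_le (K : ℕ) :
    ∑ k ∈ Finset.range K, ∑ t : Fin M.H, (M.rtdpValue π s k t.castSucc (s k t.castSucc) -
      M.rtdpValue π s (k + 1) t.castSucc (s k t.castSucc)) ≤
      (Fintype.card S : ℝ) * (M.H : ℝ) ^ 2 := by
  simp_rw [← sum_sub_rtdpValue_eq]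
  rw [Finset.sum_comm]
  calc _ = ∑ t : Fin M.H, ∑ x : S,
        (M.rtdpValue π s 0 t.castSucc x - M.rtdpValue π s K t.castSucc x) := by
        refine Finset.sum_congr rfl fun t _ => ?_
        rw [Finset.sum_comm]
        refine Finset.sum_congr rfl fun x _ => ?_
        exact Finset.sum_range_sub' (fun k => M.rtdpValue π s k t.castSucc x) K
    _ ≤ ∑ _t : Fin M.H, ∑ _x : S, (M.H : ℝ) := by
        refine Finset.sum_le_sum fun t _ => Finset.sum_le_sum fun x _ => ?_
        linarith [rtdpValue_le hg 0 t.castSucc x, rtdpValue_nonneg hg K t.castSucc x]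
    _ = (Fintype.card S : ℝ) * (M.H : ℝ) ^ 2 := by
        simp only [Finset.sum_const, Finset.card_univ, Fintype.card_fin, nsmul_eq_mul]
        ring

end Deterministic

end FiniteHorizonMDP

/-! ### Random functions evaluated at a random state -/

namespace FiniteHorizonMDP

section Measurability

lemma measurable_eval_of_finite {S Ω : Type*} [Finite S] [MeasurableSpace S]
    [DiscreteMeasurableSpace S] {m : MeasurableSpace Ω} {f : S → Ω → ℝ} {s : Ω → S}
    (hf : ∀ y, Measurable (f y)) (hs : Measurable s) : Measurable fun ω => f (s ω) ω :=
  (measurable_from_prod_countable_right (f := fun q : S × Ω => f q.1 q.2) hf).comp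
    (hs.prodMk measurable_id)

/-- A conditional law on a finite set, tested against functions known at present. -/
lemma integral_mul_eval_eq {S Ω : Type*} [Fintype S] [MeasurableSpace S]
    [DiscreteMeasurableSpace S] {m mΩ : MeasurableSpace Ω} {μ : Measure Ω} [IsFiniteMeasure μ]
    (hm : m ≤ mΩ) {s : Ω → S} (hs : Measurable s) {q : S → Ω → ℝ}
    (hq : ∀ y, μ[Set.indicator {ω | s ω = y} (fun _ => (1 : ℝ)) | m] =ᵐ[μ] q y)
    {f : S → Ω → ℝ} (hf : ∀ y, Measurable[m] (f y)) {C : ℝ} (hC : ∀ y ω, |f y ω| ≤ C) :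
    ∫ ω, f (s ω) ω ∂μ = ∫ ω, ∑ y, q y ω * f y ω ∂μ := by
  classical
  have hind : ∀ y, Integrable (Set.indicator {ω | s ω = y} (fun _ => (1 : ℝ))) μ := fun y =>
    (integrable_const 1).indicator (hs (measurableSet_singleton y))
  have hmul : ∀ y, Integrable (f y * Set.indicator {ω | s ω = y} (fun _ => (1 : ℝ))) μ := fun y =>
    (hind y).bdd_mul ((hf y).mono hm le_rfl).aestronglyMeasurable
      (Filter.Eventually.of_forall (hC y))
  -- `f y` is known at `m`, so it comes out of the conditional expectation.
  have hcond : ∀ y, μ[f y * Set.indicator {ω | s ω = y} (fun _ => (1 : ℝ)) | m] =ᵐ[μ]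
      fun ω => q y ω * f y ω := fun y => by
    refine (condExp_mul_of_stronglyMeasurable_left (hf y).stronglyMeasurable (hmul y)
      (hind y)).trans ?_
    filter_upwards [hq y] with ω hω
    rw [Pi.mul_apply, hω, mul_comm]
  calc ∫ ω, f (s ω) ω ∂μ
      = ∫ ω, ∑ y, (f y * Set.indicator {ω | s ω = y} (fun _ => (1 : ℝ))) ω ∂μ := by
        congr 1
        funext ω
        simp [Set.indicator_apply]
    _ = ∑ y, ∫ ω, (f y * Set.indicator {ω | s ω = y} (fun _ => (1 : ℝ))) ω ∂μ :=
        integral_finsetSum _ fun y _ => hmul y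
    _ = ∑ y, ∫ ω, q y ω * f y ω ∂μ := by
        refine Finset.sum_congr rfl fun y _ => ?_
        rw [← integral_condExp hm]
        exact integral_congr_ae (hcond y)
    _ = ∫ ω, ∑ y, q y ω * f y ω ∂μ :=
        (integral_finsetSum _ fun y _ => integrable_condExp.congr (hcond y)).symm

end Measurability

/-! ### Gaps and decrements along a run: recursion, bounds, measurability -/

namespace RTDPRun

variable {S A : Type*} {M : FiniteHorizonMDP S A}
  {Ω : Type*} [mΩ : MeasurableSpace Ω] {μ : Measure Ω}
  {𝓖 : Filtration (ℕ ×ₗ Fin (M.H + 1)) mΩ}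

lemma filtration_le_succ (k : ℕ) (t t' : Fin (M.H + 1)) :
    𝓖 (toLex (k, t)) ≤ 𝓖 (toLex (k + 1, t')) :=
  𝓖.mono (Prod.Lex.toLex_le_toLex.2 (Or.inl (Nat.lt_succ_self k)))

lemma filtration_le_of_le (k : ℕ) {t t' : Fin (M.H + 1)} (h : t ≤ t') :
    𝓖 (toLex (k, t)) ≤ 𝓖 (toLex (k, t')) :=
  𝓖.mono (Prod.Lex.toLex_le_toLex.2 (Or.inr ⟨rfl, h⟩))

variable [Fintype S] [MeasurableSpace S] [MeasurableSpace A] (X : M.RTDPRun μ 𝓖)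

/-- The values held by RTDP at the beginning of episode `k`. -/
noncomputable def V (k : ℕ) (t : Fin (M.H + 1)) (x : S) (ω : Ω) : ℝ :=
  M.rtdpValue (fun j => X.policy j ω) (fun j t => X.state j t ω) k t x

/-- The gap between the value held by RTDP and that of the policy it follows, at the state visited
at time-step `t` of episode `k`. -/
noncomputable def gap (k : ℕ) (t : Fin (M.H + 1)) (ω : Ω) : ℝ :=
  X.V k t (X.state k t ω) ω - M.value (X.policy k ω) t (X.state k t ω)

/-- The amount by which the value at the state visited at time-step `t` of episode `k` decreases
in that episode. -/
noncomputable def decrement (k : ℕ) (t : Fin M.H) (ω : Ω) : ℝ :=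
  X.V k t.castSucc (X.state k t.castSucc ω) ω - X.V (k + 1) t.castSucc (X.state k t.castSucc ω) ω

/-- The updated entry and the policy's value are lookaheads with the same action, so mean rewards
cancel. The update uses the old values at the next step, so the remaining difference is again a gap
of episode `k`. -/
lemma gap_castSucc (k : ℕ) (t : Fin M.H) (ω : Ω) :
    X.gap k t.castSucc ω = X.decrement k t ω +
      ∑ y, (M.p (X.state k t.castSucc ω) (X.policy k ω t (X.state k t.castSucc ω)) y).toReal *
        (X.V k t.succ y ω - M.value (X.policy k ω) t.succ y) := by
  have h : X.V (k + 1) t.castSucc (X.state k t.castSucc ω) ω = _ :=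
    M.rtdpValue_succ_self (fun j => X.policy j ω) (fun j t => X.state j t ω) k t
  rw [gap, decrement, h, Fin.val_castSucc, value_eq_lookahead]
  simp_rw [mul_sub, Finset.sum_sub_distrib]
  simp only [lookahead, V, Fin.val_succ]
  ring

lemma gap_last (k : ℕ) (ω : Ω) : X.gap k (Fin.last M.H) ω = 0 := by
  simp [gap, V, rtdpValue_last, value_horizon]

lemma V_le (k : ℕ) (t : Fin (M.H + 1)) (x : S) (ω : Ω) : X.V k t x ω ≤ M.H :=
  rtdpValue_le (fun k => X.greedy k ω) k t x

lemma V_nonneg (k : ℕ) (t : Fin (M.H + 1)) (x : S) (ω : Ω) : 0 ≤ X.V k t x ω :=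
  rtdpValue_nonneg (fun k => X.greedy k ω) k t x

lemma value_le_V (k : ℕ) (ρ : M.Policy) (t : Fin (M.H + 1)) (x : S) (ω : Ω) :
    M.value ρ t x ≤ X.V k t x ω :=
  value_le_rtdpValue (fun k => X.greedy k ω) k ρ t x

lemma gap_nonneg (k : ℕ) (t : Fin (M.H + 1)) (ω : Ω) : 0 ≤ X.gap k t ω :=
  sub_nonneg.2 (X.value_le_V k _ t _ ω)

lemma abs_V_sub_value_le (k : ℕ) (ρ : M.Policy) (t : Fin (M.H + 1)) (x : S) (ω : Ω) :
    |X.V k t x ω - M.value ρ t x| ≤ M.H := by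
  rw [abs_of_nonneg (sub_nonneg.2 (X.value_le_V k ρ t x ω))]
  linarith [X.V_le k t x ω, M.value_nonneg ρ t x]

lemma gap_le (k : ℕ) (t : Fin (M.H + 1)) (ω : Ω) : X.gap k t ω ≤ M.H :=
  (le_abs_self _).trans (X.abs_V_sub_value_le k _ t _ ω)

lemma decrement_nonneg (k : ℕ) (t : Fin M.H) (ω : Ω) : 0 ≤ X.decrement k t ω :=
  sub_nonneg.2 (rtdpValue_succ_le (fun k => X.greedy k ω) k _ _)

lemma decrement_le (k : ℕ) (t : Fin M.H) (ω : Ω) : X.decrement k t ω ≤ M.H := by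
  unfold decrement
  linarith [X.V_le k t.castSucc (X.state k t.castSucc ω) ω,
    X.V_nonneg (k + 1) t.castSucc (X.state k t.castSucc ω) ω]

lemma sum_decrement_le_sq (k : ℕ) (ω : Ω) : ∑ t, X.decrement k t ω ≤ (M.H : ℝ) ^ 2 :=
  calc ∑ t, X.decrement k t ω ≤ ∑ _t : Fin M.H, (M.H : ℝ) :=
        Finset.sum_le_sum fun t _ => X.decrement_le k t ω
    _ = (M.H : ℝ) ^ 2 := by simp [sq]

lemma sum_sum_decrement_le (K : ℕ) (ω : Ω) :
    ∑ k ∈ Finset.range K, ∑ t, X.decrement k t ω ≤ (Fintype.card S : ℝ) * (M.H : ℝ) ^ 2 :=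
  sum_decrement_le (fun k => X.greedy k ω) K

lemma regret_term_nonneg (k : ℕ) (ω : Ω) :
    0 ≤ M.optValue 0 (X.state k 0 ω) - M.value (X.policy k ω) 0 (X.state k 0 ω) :=
  sub_nonneg.2 (le_ciSup (M.bddAbove_range_value 0 (X.state k 0 ω)) (X.policy k ω))

lemma regret_mono (ω : Ω) : Monotone fun K => X.regret K ω :=
  monotone_nat_of_le_succ fun K => by
    unfold regret
    rw [Finset.sum_range_succ]
    exact le_add_of_nonneg_right (X.regret_term_nonneg K ω)

lemma regret_nonneg (K : ℕ) (ω : Ω) : 0 ≤ X.regret K ω :=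
  Finset.sum_nonneg fun k _ => X.regret_term_nonneg k ω

lemma regret_le_sum_gap (K : ℕ) (ω : Ω) : X.regret K ω ≤ ∑ k ∈ Finset.range K, X.gap k 0 ω :=
  Finset.sum_le_sum fun k _ => sub_le_sub_right
    (optValue_le_rtdpValue (fun k => X.greedy k ω) k 0 (X.state k 0 ω)) _

lemma measurable_action (k : ℕ) (t : Fin M.H) (x : S) :
    Measurable[𝓖 (toLex (k, 0))] fun ω => X.policy k ω t x :=
  (measurable_pi_apply x).comp ((measurable_pi_apply t).comp (X.measurable_policy k))

variable [DiscreteMeasurableSpace S] [DiscreteMeasurableSpace A]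

lemma measurable_V (k : ℕ) (t : Fin (M.H + 1)) (x : S) :
    Measurable[𝓖 (toLex (k, 0))] (X.V k t x) := by
  induction k generalizing t x with
  | zero =>
    have : X.V 0 t x = fun _ => (M.H : ℝ) - (t : ℕ) := rfl
    rw [this]
    exact measurable_const
  | succ k ih =>
    have hle := filtration_le_succ (𝓖 := 𝓖) k 0 0
    induction t using Fin.lastCases with
    | last =>
      have : X.V (k + 1) (Fin.last M.H) x = fun _ => 0 := by
        funext ω
        exact M.rtdpValue_last _ _ _ _
      rw [this]
      exact measurable_const
    | cast t =>
      classical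
      have heq : X.V (k + 1) t.castSucc x = fun ω => if X.state k t.castSucc ω = x then
          M.lookahead (fun y => X.V k t.succ y ω) x (X.policy k ω t x)
          else X.V k t.castSucc x ω := by
        funext ω
        split_ifs with h
        · subst h
          exact M.rtdpValue_succ_self _ _ k t
        · exact M.rtdpValue_succ_of_ne _ _ k _ (Ne.symm h)
      rw [heq]
      refine Measurable.ite ?_ ?_ ((ih _ x).mono hle le_rfl)
      · exact (X.measurable_state k t.castSucc).mono (filtration_le_succ k _ 0) le_rfl
          (measurableSet_singleton x)
      · refine Measurable.mono ?_ hle le_rfl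
        have ha := X.measurable_action k t x
        refine Measurable.add ((Measurable.of_discrete (f := M.r x)).comp ha)
          (Finset.measurable_fun_sum _ fun y _ => Measurable.mul ?_ (ih _ y))
        exact (Measurable.of_discrete (f := fun a => (M.p x a y).toReal)).comp ha

lemma measurable_decrement (k : ℕ) (t : Fin M.H) :
    Measurable[𝓖 (toLex (k + 1, 0))] (X.decrement k t) := by
  have hs := (X.measurable_state k t.castSucc).mono (filtration_le_succ k _ 0) le_rfl
  have h₁ : Measurable[𝓖 (toLex (k + 1, 0))]
      fun ω => X.V k t.castSucc (X.state k t.castSucc ω) ω :=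
    measurable_eval_of_finite (f := X.V k t.castSucc)
      (fun y => (X.measurable_V k t.castSucc y).mono (filtration_le_succ k 0 0) le_rfl) hs
  have h₂ : Measurable[𝓖 (toLex (k + 1, 0))]
      fun ω => X.V (k + 1) t.castSucc (X.state k t.castSucc ω) ω :=
    measurable_eval_of_finite (f := X.V (k + 1) t.castSucc)
      (fun y => X.measurable_V (k + 1) t.castSucc y) hs
  exact h₁.sub h₂

variable [Fintype A]

lemma measurable_policy_state (k : ℕ) (t : Fin (M.H + 1)) (f : M.Policy × S → ℝ) :
    Measurable[𝓖 (toLex (k, t))] fun ω => f (X.policy k ω, X.state k t ω) := by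
  have hle := filtration_le_of_le (𝓖 := 𝓖) k (Fin.zero_le t)
  have hf : Measurable f := Measurable.of_discrete
  exact hf.comp (((X.measurable_policy k).mono hle le_rfl).prodMk (X.measurable_state k t))

lemma measurable_gap (k : ℕ) (t : Fin (M.H + 1)) : Measurable[𝓖 (toLex (k, t))] (X.gap k t) := by
  have hle := filtration_le_of_le (𝓖 := 𝓖) k (Fin.zero_le t)
  have hV : Measurable[𝓖 (toLex (k, t))] fun ω => X.V k t (X.state k t ω) ω :=
    measurable_eval_of_finite (f := X.V k t) (fun y => (X.measurable_V k t y).mono hle le_rfl)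
      (X.measurable_state k t)
  exact hV.sub (X.measurable_policy_state k t fun q => M.value q.1 t q.2)

lemma measurable_regret (K : ℕ) : Measurable (X.regret K) :=
  Finset.measurable_fun_sum _ fun k _ => (X.measurable_policy_state k 0
    fun q => M.optValue 0 q.2 - M.value q.1 0 q.2).mono (𝓖.le _) le_rfl

omit [DiscreteMeasurableSpace S] in
lemma measurable_value_policy (k : ℕ) (t : ℕ) (y : S) :
    Measurable[𝓖 (toLex (k, 0))] fun ω => M.value (X.policy k ω) t y :=
  have hf : Measurable fun ρ : M.Policy => M.value ρ t y := Measurable.of_discrete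
  hf.comp (X.measurable_policy k)

end RTDPRun

end FiniteHorizonMDP

/-! ### Expected gaps and the expected regret -/

namespace FiniteHorizonMDP

namespace RTDPRun

variable {S A : Type*} [Fintype S] [Fintype A] [MeasurableSpace S] [DiscreteMeasurableSpace S]
  [MeasurableSpace A] [DiscreteMeasurableSpace A] {M : FiniteHorizonMDP S A}
  {Ω : Type*} [mΩ : MeasurableSpace Ω] {μ : Measure Ω} [IsFiniteMeasure μ]
  {𝓖 : Filtration (ℕ ×ₗ Fin (M.H + 1)) mΩ} (X : M.RTDPRun μ 𝓖)

omit [IsFiniteMeasure μ] in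
lemma integrable_mul_gap (k : ℕ) (t : Fin (M.H + 1)) {W : Ω → ℝ}
    (hW : Integrable W μ) : Integrable (fun ω => W ω * X.gap k t ω) μ :=
  hW.mul_bdd (c := M.H) ((X.measurable_gap k t).mono (𝓖.le _) le_rfl).aestronglyMeasurable
    (Filter.Eventually.of_forall fun ω => by
      rw [Real.norm_of_nonneg (X.gap_nonneg k t ω)]
      exact X.gap_le k t ω)

omit [Fintype A] [IsFiniteMeasure μ] in
lemma integrable_mul_decrement (k : ℕ) (t : Fin M.H) {W : Ω → ℝ}
    (hW : Integrable W μ) : Integrable (fun ω => W ω * X.decrement k t ω) μ :=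
  hW.mul_bdd (c := M.H) ((X.measurable_decrement k t).mono (𝓖.le _) le_rfl).aestronglyMeasurable
    (Filter.Eventually.of_forall fun ω => by
      rw [Real.norm_of_nonneg (X.decrement_nonneg k t ω)]
      exact X.decrement_le k t ω)

variable {k : ℕ} {W : Ω → ℝ} {C : ℝ}

/-- Integrated form of `gap_castSucc`: testing against all bounded weights known at the start of the
episode replaces conditioning. The values and the policy are fixed by then, so only the next state
is averaged. -/
lemma integral_mul_gap_succ (t : Fin M.H) (hW : Measurable[𝓖 (toLex (k, 0))] W)
    (hC : ∀ ω, |W ω| ≤ C) :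
    ∫ ω, W ω * X.gap k t.castSucc ω ∂μ =
      ∫ ω, W ω * X.decrement k t ω ∂μ + ∫ ω, W ω * X.gap k t.succ ω ∂μ := by
  have hle : 𝓖 (toLex (k, 0)) ≤ 𝓖 (toLex (k, t.castSucc)) :=
    filtration_le_of_le k (Fin.zero_le _)
  have hWint : Integrable W μ :=
    Integrable.of_bound ((hW.mono (𝓖.le _) le_rfl).aestronglyMeasurable) C
      (Filter.Eventually.of_forall hC)
  let f : S → Ω → ℝ := fun y ω => W ω * (X.V k t.succ y ω - M.value (X.policy k ω) t.succ y)
  have hf : ∀ y, Measurable[𝓖 (toLex (k, t.castSucc))] (f y) := fun y =>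
    (hW.mul ((X.measurable_V k t.succ y).sub
      (X.measurable_value_policy k t.succ y))).mono hle le_rfl
  have hfC : ∀ y ω, |f y ω| ≤ C * M.H := fun y ω => by
    rw [abs_mul]
    exact mul_le_mul (hC ω) (X.abs_V_sub_value_le k _ t.succ y ω) (abs_nonneg _)
      ((abs_nonneg _).trans (hC ω))
  have key := integral_mul_eval_eq (𝓖.le _)
    ((X.measurable_state k t.succ).mono (𝓖.le _) le_rfl) (X.condLaw_state k t) hf hfC
  have hsucc : ∫ ω, W ω * X.gap k t.succ ω ∂μ = ∫ ω, f (X.state k t.succ ω) ω ∂μ := rfl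
  rw [← sub_eq_iff_eq_add', hsucc, key, ← integral_sub (X.integrable_mul_gap k _ hWint)
    (X.integrable_mul_decrement k t hWint)]
  congr 1
  funext ω
  rw [gap_castSucc, mul_add, add_sub_cancel_left, Finset.mul_sum]
  exact Finset.sum_congr rfl fun y _ => mul_left_comm _ _ _

/-- The expected gap at the start of an episode is the expected total decrease in the episode,
conditionally on the information available at the start of the episode. -/
lemma integral_mul_gap_zero (hW : Measurable[𝓖 (toLex (k, 0))] W) (hC : ∀ ω, |W ω| ≤ C) :
    ∫ ω, W ω * X.gap k 0 ω ∂μ = ∫ ω, W ω * ∑ t, X.decrement k t ω ∂μ := by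
  have hWint : Integrable W μ :=
    Integrable.of_bound ((hW.mono (𝓖.le _) le_rfl).aestronglyMeasurable) C
      (Filter.Eventually.of_forall hC)
  have htel : ∑ t : Fin M.H, ∫ ω, W ω * X.decrement k t ω ∂μ =
      ∫ ω, W ω * X.gap k 0 ω ∂μ - ∫ ω, W ω * X.gap k (Fin.last M.H) ω ∂μ := by
    rw [← Finset.sum_congr rfl fun t _ =>
      (eq_sub_iff_add_eq.2 (X.integral_mul_gap_succ t hW hC).symm).symm,
      Finset.sum_sub_distrib, sub_eq_sub_iff_add_eq_add]
    -- Splitting off the first and the last term of the same sum yields the telescoping.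
    have h₁ := Fin.sum_univ_succ fun t : Fin (M.H + 1) => ∫ ω, W ω * X.gap k t ω ∂μ
    have h₂ := Fin.sum_univ_castSucc fun t : Fin (M.H + 1) => ∫ ω, W ω * X.gap k t ω ∂μ
    linarith
  simp only [gap_last, mul_zero, integral_zero, sub_zero] at htel
  rw [← htel, ← integral_finsetSum _ fun t _ => X.integrable_mul_decrement k t hWint]
  simp_rw [Finset.mul_sum]

lemma integrable_regret (K : ℕ) : Integrable (X.regret K) μ :=
  Integrable.of_bound (X.measurable_regret K).aestronglyMeasurable (K * M.H)
    (Filter.Eventually.of_forall fun ω => by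
      rw [Real.norm_of_nonneg (X.regret_nonneg K ω)]
      refine (X.regret_le_sum_gap K ω).trans
        ((Finset.sum_le_sum fun k _ => X.gap_le k 0 ω).trans ?_)
      simp)

lemma integral_regret_le [IsProbabilityMeasure μ] (K : ℕ) :
    ∫ ω, X.regret K ω ∂μ ≤ (Fintype.card S : ℝ) * (M.H : ℝ) ^ 2 := by
  have hg : ∀ k, Integrable (X.gap k 0) μ := fun k => by
    simpa using X.integrable_mul_gap k 0 (integrable_const (1 : ℝ))
  have hd : ∀ k, Integrable (fun ω => ∑ t, X.decrement k t ω) μ := fun k =>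
    integrable_finsetSum _ fun t _ => by
      simpa using X.integrable_mul_decrement k t (integrable_const (1 : ℝ))
  calc ∫ ω, X.regret K ω ∂μ
      ≤ ∫ ω, ∑ k ∈ Finset.range K, X.gap k 0 ω ∂μ :=
        integral_mono (X.integrable_regret K) (integrable_finsetSum _ fun k _ => hg k)
          fun ω => X.regret_le_sum_gap K ω
    _ = ∑ k ∈ Finset.range K, ∫ ω, X.gap k 0 ω ∂μ := integral_finsetSum _ fun k _ => hg k
    _ = ∑ k ∈ Finset.range K, ∫ ω, ∑ t, X.decrement k t ω ∂μ :=
        Finset.sum_congr rfl fun k _ => by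
          simpa using X.integral_mul_gap_zero (k := k) (W := fun _ => 1) measurable_const
            (C := 1) (by simp)
    _ = ∫ ω, ∑ k ∈ Finset.range K, ∑ t, X.decrement k t ω ∂μ :=
        (integral_finsetSum _ fun k _ => hd k).symm
    _ ≤ ∫ _, (Fintype.card S : ℝ) * (M.H : ℝ) ^ 2 ∂μ :=
        integral_mono (integrable_finsetSum _ fun k _ => hd k) (integrable_const _)
          fun ω => X.sum_sum_decrement_le K ω
    _ = (Fintype.card S : ℝ) * (M.H : ℝ) ^ 2 := by simp

end RTDPRun

end FiniteHorizonMDP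

/-! ### Exponential supermartingale and the high-probability bound -/

namespace FiniteHorizonMDP

lemma exp_neg_le_one_sub_half {y : ℝ} (h₀ : 0 ≤ y) (h₁ : y ≤ 1) : Real.exp (-y) ≤ 1 - y / 2 := by
  rw [Real.exp_neg]
  have h := Real.add_one_le_exp y
  calc (Real.exp y)⁻¹ ≤ (y + 1)⁻¹ := by gcongr
    _ ≤ 1 - y / 2 := by
      rw [inv_le_iff_one_le_mul₀ (by linarith)]
      nlinarith

namespace RTDPRun

variable {S A : Type*} [Fintype S] [Fintype A] [MeasurableSpace S] [DiscreteMeasurableSpace S]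
  [MeasurableSpace A] [DiscreteMeasurableSpace A] {M : FiniteHorizonMDP S A}
  {Ω : Type*} [mΩ : MeasurableSpace Ω] {μ : Measure Ω} [IsProbabilityMeasure μ]
  {𝓖 : Filtration (ℕ ×ₗ Fin (M.H + 1)) mΩ} (X : M.RTDPRun μ 𝓖)

/-- The exponential supermartingale that compares the gaps with the decreases of the values. -/
noncomputable def expGap (K : ℕ) (ω : Ω) : ℝ :=
  Real.exp (∑ k ∈ Finset.range K,
    (X.gap k 0 ω / (2 * (M.H : ℝ) ^ 2) - (∑ t, X.decrement k t ω) / (M.H : ℝ) ^ 2))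

omit [IsProbabilityMeasure μ] in
lemma measurable_expGap (K : ℕ) : Measurable[𝓖 (toLex (K, 0))] (X.expGap K) := by
  refine Real.measurable_exp.comp (Finset.measurable_fun_sum _ fun k hk => ?_)
  have hk : k + 1 ≤ K := Finset.mem_range.1 hk
  have hle : 𝓖 (toLex (k + 1, 0)) ≤ 𝓖 (toLex (K, 0)) :=
    𝓖.mono (Prod.Lex.toLex_mono ⟨hk, le_rfl⟩)
  refine Measurable.mono ?_ hle le_rfl
  exact (((X.measurable_gap k 0).mono (filtration_le_succ k 0 0) le_rfl).div_const _).sub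
    ((Finset.measurable_fun_sum _ fun t _ => X.measurable_decrement k t).div_const _)

omit [Fintype A] [DiscreteMeasurableSpace S] [DiscreteMeasurableSpace A]
  [IsProbabilityMeasure μ] in
-- A crude bound, needed only for integrability and for a bounded weight in `integral_mul_gap_zero`.
lemma expGap_mul_exp_le (K : ℕ) (ω : Ω) :
    X.expGap K ω * Real.exp (X.gap K 0 ω / (2 * (M.H : ℝ) ^ 2)) ≤
      Real.exp ((K + 1) * (M.H / (2 * (M.H : ℝ) ^ 2))) := by
  have hgap : ∀ k, X.gap k 0 ω / (2 * (M.H : ℝ) ^ 2) ≤ M.H / (2 * (M.H : ℝ) ^ 2) := fun k => by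
    gcongr
    exact X.gap_le k 0 ω
  have hsum : ∑ k ∈ Finset.range K, (X.gap k 0 ω / (2 * (M.H : ℝ) ^ 2) -
      (∑ t, X.decrement k t ω) / (M.H : ℝ) ^ 2) ≤ K * (M.H / (2 * (M.H : ℝ) ^ 2)) := by
    calc _ ≤ ∑ k ∈ Finset.range K, (M.H / (2 * (M.H : ℝ) ^ 2) : ℝ) := by
          refine Finset.sum_le_sum fun k _ => (sub_le_self _ ?_).trans (hgap k)
          exact div_nonneg (Finset.sum_nonneg fun t _ => X.decrement_nonneg k t ω) (sq_nonneg _)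
      _ = _ := by simp
  rw [expGap, ← Real.exp_add]
  refine Real.exp_le_exp.2 ?_
  linarith [hgap K]

lemma integrable_expGap (K : ℕ) : Integrable (X.expGap K) μ :=
  Integrable.of_bound ((X.measurable_expGap K).mono (𝓖.le _) le_rfl).aestronglyMeasurable
    (Real.exp ((K + 1) * (M.H / (2 * (M.H : ℝ) ^ 2)))) (Filter.Eventually.of_forall fun ω => by
      rw [expGap, Real.norm_of_nonneg (Real.exp_nonneg _)]
      refine le_trans (le_mul_of_one_le_right (Real.exp_nonneg _) ?_) (X.expGap_mul_exp_le K ω)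
      exact Real.one_le_exp (div_nonneg (X.gap_nonneg K 0 ω) (by positivity)))

/-- Since `exp (-y) ≤ 1 - y / 2` on `[0, 1]`, the decrease contributes a mean factor at most `1 - g
/ (2 * B) ≤ exp (-g / (2 * B))`, which cancels the factor from the gap. This is where the 2 in
`expGap` comes from. -/
lemma integral_expGap_succ_le (hH : 0 < M.H) (K : ℕ) :
    ∫ ω, X.expGap (K + 1) ω ∂μ ≤ ∫ ω, X.expGap K ω ∂μ := by
  have hB : 0 < (M.H : ℝ) ^ 2 := by positivity
  set B : ℝ := (M.H : ℝ) ^ 2 with hBdef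
  let D : Ω → ℝ := fun ω => ∑ t, X.decrement K t ω
  -- `W` collects the factors of `expGap (K + 1)` known when episode `K` starts.
  let W : Ω → ℝ := fun ω => X.expGap K ω * Real.exp (X.gap K 0 ω / (2 * B))
  have hW0 : ∀ ω, 0 ≤ W ω := fun ω => mul_nonneg (Real.exp_nonneg _) (Real.exp_nonneg _)
  have hW : Measurable[𝓖 (toLex (K, 0))] W :=
    (X.measurable_expGap K).mul
      (Real.measurable_exp.comp ((X.measurable_gap K 0).div_const _))
  have hC : ∀ ω, |W ω| ≤ Real.exp ((K + 1) * (M.H / (2 * B))) := fun ω => by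
    rw [abs_of_nonneg (hW0 ω)]
    exact X.expGap_mul_exp_le K ω
  have hWint : Integrable W μ :=
    Integrable.of_bound ((hW.mono (𝓖.le _) le_rfl).aestronglyMeasurable) _
      (Filter.Eventually.of_forall hC)
  have hWD : Integrable (fun ω => W ω * D ω) μ := by
    simp_rw [D, Finset.mul_sum]
    exact integrable_finsetSum _ fun t _ => X.integrable_mul_decrement K t hWint
  have hWg := X.integrable_mul_gap K 0 hWint
  have hup : ∀ ω, X.expGap (K + 1) ω ≤ W ω - W ω * D ω / (2 * B) := fun ω => by
    have hD0 : 0 ≤ D ω / B :=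
      div_nonneg (Finset.sum_nonneg fun t _ => X.decrement_nonneg K t ω) hB.le
    have hD1 : D ω / B ≤ 1 := (div_le_one hB).2 (X.sum_decrement_le_sq K ω)
    have hsplit : X.expGap (K + 1) ω = W ω * Real.exp (-(D ω / B)) := by
      simp only [W, D, expGap, Finset.sum_range_succ, ← Real.exp_add]
      congr 1
      ring
    rw [hsplit]
    refine (mul_le_mul_of_nonneg_left (exp_neg_le_one_sub_half hD0 hD1) (hW0 ω)).trans_eq ?_
    field_simp
  have hlow : ∀ ω, W ω - W ω * X.gap K 0 ω / (2 * B) ≤ X.expGap K ω := fun ω => by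
    have hsplit : X.expGap K ω = W ω * Real.exp (-(X.gap K 0 ω / (2 * B))) := by
      simp only [W]
      rw [mul_assoc, ← Real.exp_add, add_neg_cancel, Real.exp_zero, mul_one]
    rw [hsplit]
    refine le_trans (le_of_eq ?_)
      (mul_le_mul_of_nonneg_left (Real.one_sub_le_exp_neg (X.gap K 0 ω / (2 * B))) (hW0 ω))
    ring
  calc ∫ ω, X.expGap (K + 1) ω ∂μ
      ≤ ∫ ω, (W ω - W ω * D ω / (2 * B)) ∂μ :=
        integral_mono (X.integrable_expGap _) (hWint.sub (hWD.div_const _)) hup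
    _ = ∫ ω, (W ω - W ω * X.gap K 0 ω / (2 * B)) ∂μ := by
        rw [integral_sub hWint (hWD.div_const _), integral_sub hWint (hWg.div_const _),
          integral_div, integral_div, X.integral_mul_gap_zero hW hC]
    _ ≤ ∫ ω, X.expGap K ω ∂μ :=
        integral_mono (hWint.sub (hWg.div_const _)) (X.integrable_expGap K) hlow

lemma integral_expGap_le_one (hH : 0 < M.H) (K : ℕ) : ∫ ω, X.expGap K ω ∂μ ≤ 1 := by
  induction K with
  | zero => simp [expGap]
  | succ K ih => exact (X.integral_expGap_succ_le hH K).trans ih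

/-- Large regret forces `expGap` to be large, because the total decrease is at most `S * H ^ 2`
surely; Markov's inequality concludes. -/
lemma measureReal_lt_regret_le (hH : 0 < M.H) (K : ℕ) (T : ℝ) :
    μ.real {ω | T < X.regret K ω} ≤ Real.exp (Fintype.card S - T / (2 * (M.H : ℝ) ^ 2)) := by
  have hB : 0 < (M.H : ℝ) ^ 2 := by positivity
  have hsub : {ω | T < X.regret K ω} ⊆
      {ω | Real.exp (T / (2 * (M.H : ℝ) ^ 2) - Fintype.card S) ≤ X.expGap K ω} := by
    intro ω hω
    refine Real.exp_le_exp.2 ?_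
    rw [Finset.sum_sub_distrib, ← Finset.sum_div, ← Finset.sum_div]
    have h₁ : T ≤ ∑ k ∈ Finset.range K, X.gap k 0 ω := hω.le.trans (X.regret_le_sum_gap K ω)
    have h₂ := X.sum_sum_decrement_le K ω
    gcongr
    rwa [div_le_iff₀ hB]
  have hmarkov := mul_meas_ge_le_integral_of_nonneg (μ := μ) (f := X.expGap K)
    (Filter.Eventually.of_forall fun ω => Real.exp_nonneg _) (X.integrable_expGap K)
    (Real.exp (T / (2 * (M.H : ℝ) ^ 2) - Fintype.card S))
  rw [← neg_sub, Real.exp_neg, ← one_div, le_div_iff₀ (Real.exp_pos _), mul_comm]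
  exact (mul_le_mul_of_nonneg_left (measureReal_mono hsub) (Real.exp_nonneg _)).trans
    (hmarkov.trans (X.integral_expGap_le_one hH K))

/-- The bad events increase with `K`, so their union has the same bound as each of them. -/
lemma one_sub_le_measureReal_regret_le (hH : 0 < M.H) {T δ : ℝ}
    (hT : Real.exp (Fintype.card S - T / (2 * (M.H : ℝ) ^ 2)) ≤ δ) :
    1 - δ ≤ μ.real {ω | ∀ K : ℕ, 0 < K → X.regret K ω ≤ T} := by
  have hδ : 0 ≤ δ := (Real.exp_nonneg _).trans hT
  have hmono : Monotone fun K => {ω | T < X.regret K ω} := fun K K' h ω hω =>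
    lt_of_lt_of_le hω (X.regret_mono ω h)
  have hmeas : MeasurableSet (⋃ K, {ω | T < X.regret K ω}) :=
    MeasurableSet.iUnion fun K => measurableSet_lt measurable_const (X.measurable_regret K)
  have hbad : μ (⋃ K, {ω | T < X.regret K ω}) ≤ ENNReal.ofReal δ := by
    rw [hmono.measure_iUnion]
    refine iSup_le fun K => ?_
    rw [← ofReal_measureReal]
    exact ENNReal.ofReal_le_ofReal ((X.measureReal_lt_regret_le hH K T).trans hT)
  have hbad' : μ.real (⋃ K, {ω | T < X.regret K ω}) ≤ δ := ENNReal.toReal_le_of_le_ofReal hδ hbad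
  have hsub : (⋃ K, {ω | T < X.regret K ω})ᶜ ⊆ {ω | ∀ K : ℕ, 0 < K → X.regret K ω ≤ T} := by
    intro ω hω K _
    by_contra h
    exact hω (Set.mem_iUnion.2 ⟨K, not_le.1 h⟩)
  calc 1 - δ ≤ 1 - μ.real (⋃ K, {ω | T < X.regret K ω}) := by linarith
    _ = μ.real (⋃ K, {ω | T < X.regret K ω})ᶜ := (probReal_compl_eq_one_sub hmeas).symm
    _ ≤ _ := measureReal_mono hsub

end RTDPRun

/-- As `3 > e`, the logarithm is at least `1 + log (1 / δ)`, and `9 / 2 * n * (1 + log (1 / δ))`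
exceeds `n + log (1 / δ)`. -/
lemma exp_sub_log_le {n h δ : ℝ} (hn : 1 ≤ n) (hh : 1 ≤ h) (hδ : 0 < δ) (hδ1 : δ ≤ 1) :
    Real.exp (n - 9 * n * h ^ 2 * Real.log (3 * n * h / δ) / (2 * h ^ 2)) ≤ δ := by
  have hlog : 1 - Real.log δ ≤ Real.log (3 * n * h / δ) := by
    rw [Real.log_div (by positivity) hδ.ne']
    gcongr
    rw [Real.le_log_iff_exp_le (by positivity)]
    have hnh : 1 ≤ n * h := one_le_mul_of_one_le_of_one_le hn hh
    linarith [Real.exp_one_lt_d9]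
  have hlogδ : Real.log δ ≤ 0 := Real.log_nonpos hδ.le hδ1
  rw [← Real.le_log_iff_exp_le hδ]
  have hdiv : 9 * n * h ^ 2 * Real.log (3 * n * h / δ) / (2 * h ^ 2) =
      9 / 2 * n * Real.log (3 * n * h / δ) := by
    field_simp
  rw [hdiv]
  nlinarith [mul_le_mul_of_nonneg_left hlog (by linarith : (0 : ℝ) ≤ n)]

end FiniteHorizonMDP

theorem mainTheorem2 {S A : Type*} [Fintype S] [Fintype A] [Nonempty S] [Nonempty A]
    [MeasurableSpace S] [DiscreteMeasurableSpace S]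
    [MeasurableSpace A] [DiscreteMeasurableSpace A]
    (M : FiniteHorizonMDP S A)
    {Ω : Type*} [mΩ : MeasurableSpace Ω] (μ : MeasureTheory.Measure Ω)
    [MeasureTheory.IsProbabilityMeasure μ]
    (𝓖 : MeasureTheory.Filtration (ℕ ×ₗ Fin (M.H + 1)) mΩ)
    (X : M.RTDPRun μ 𝓖) :
    (∀ K : ℕ, MeasureTheory.Integrable (X.regret K) μ ∧
      ∫ ω, X.regret K ω ∂μ ≤ (Fintype.card S : ℝ) * (M.H : ℝ) ^ 2) ∧
    (∀ δ : ℝ, 0 < δ →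
      1 - δ ≤ μ.real {ω | ∀ K : ℕ, 0 < K →
        X.regret K ω ≤
          9 * (Fintype.card S : ℝ) * (M.H : ℝ) ^ 2 *
            Real.log (3 * (Fintype.card S : ℝ) * (M.H : ℝ) / δ)}) := by
  refine ⟨fun K => ⟨X.integrable_regret K, X.integral_regret_le K⟩, fun δ hδ => ?_⟩
  rcases le_total 1 δ with hδ1 | hδ1
  · exact (sub_nonpos.2 hδ1).trans measureReal_nonneg
  -- The exponential argument divides by `H ^ 2`; for `H = 0` the gaps are at most 0 and so is the
  -- claimed bound.
  rcases Nat.eq_zero_or_pos M.H with hH | hH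
  · have huniv : ∀ ω K, X.regret K ω ≤ 0 := fun ω K =>
      (X.regret_le_sum_gap K ω).trans (Finset.sum_nonpos fun k _ => by
        simpa [hH] using X.gap_le k 0 ω)
    simp [hH, huniv, hδ.le]
  · exact X.one_sub_le_measureReal_regret_le hH
      (FiniteHorizonMDP.exp_sub_log_le (by exact_mod_cast Fintype.card_pos)
        (by exact_mod_cast hH) hδ hδ1)
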